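/- For $n\ge 1$ and $\beta\in\mathbb R$, let $X_1,\dots,X_n$ be i.i.d. with $\mathbb P(X_k=1)=\mathbb P(X_k=-1)=\tfrac12$, let $S_n=\sum_{k=1}^n X_k$, and let $(X^{(\beta)}_1,\dots,X^{(\beta)}_n)$ be the Curie–Weiss spins at inverse temperature $\beta$, i.e. a random vector whose law is $$\frac{e^{\frac{\beta}{2n}S_n^2}}{\mathbb E\big[e^{\frac{\beta}{2n}S_n^2}\big]}\bullet \mathbb P_{(X_1,\dots,X_n)},$$ the law of $(X_1,\dots,X_n)$ reweighted by the displayed density. Let $M_n^{(\beta)}=\sum_{k=1}^n X_k^{(\beta)}$ be the unnormalised magnetisation. For $\gamma\in\mathbb R$ let $F_\gamma$ be a real random variable with density $\frac1{\mathcal Z_\gamma}e^{-\gamma x^2/2-x^4/12}$, where $\mathcal Z_\gamma=\int_{\mathbb R}e^{-\gamma x^2/2-x^4/12}\,dx$, and let $B$ be a random sign, $\mathbb P(B=1)=\mathbb P(B=-1)=\tfrac12$. All convergences below are in distribution as $n\to\infty$. 1. If $\beta<1$, then $\dfrac{M_n^{(\beta)}}{\sqrt n}\to\mathcal N\!\left(0,\dfrac1{1-\beta}\right)$.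 2. If $\beta=1$, then $\dfrac{M_n^{(1)}}{n^{3/4}}\to F_0$, whose density is proportional to $e^{-x^4/12}$. Moreover $F_0$ has the same law as $B\,\big(12\,\boldsymbol\gamma(1/4)\big)^{1/4}$, where $\boldsymbol\gamma(1/4)$ is independent of $B$ and Gamma-distributed with density $\frac{1}{\Gamma(1/4)}x^{-3/4}e^{-x}\mathbf 1_{x>0}$. 3. For every fixed $\gamma\in\mathbb R$, $\dfrac{M_n^{(1-\gamma/\sqrt n)}}{n^{3/4}}\to F_\gamma$. 4. If $\beta>1$, the equation $t=\tanh(\beta t)$ has exactly one solution $t_\beta>0$, and $\dfrac{M_n^{(\beta)}}{n}\to t_\beta\,B$. -/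

import Mathlib

open MeasureTheory ProbabilityTheory Filter

noncomputable section

namespace CurieWeiss

/-- The symmetric sign law `Ber_{±1}(1/2)` on `ℝ`: mass `1/2` at `1` and mass `1/2` at `-1`. -/
def signLaw : Measure ℝ :=
  bernoulliMeasure (1 : ℝ) (-1) (⟨1 / 2, by norm_num, by norm_num⟩ : unitInterval)

instance : IsProbabilityMeasure signLaw := by
  unfold signLaw; infer_instance

/-- The total spin `∑ₖ xₖ` of a configuration of `n` spins. Under the law `spinLaw n β` this is
the unnormalised magnetisation. -/
def magnetisation (n : ℕ) (x : Fin n → ℝ) : ℝ := ∑ k, x k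

/-- The Curie-Weiss law of `n` spins at inverse temperature `β` and zero external field: the law of
`n` i.i.d. symmetric signs, tilted by the normalised weight `exp (β / (2 n) * (∑ₖ xₖ) ^ 2)`. -/
def spinLaw (n : ℕ) (β : ℝ) : Measure (Fin n → ℝ) :=
  (Measure.pi fun _ : Fin n => signLaw).tilted
    fun x => β / (2 * n) * magnetisation n x ^ 2

/-- The law on `ℝ` whose density is proportional to `exp (-γ x² / 2 - x⁴ / 12)`. -/
def quarticLaw (γ : ℝ) : Measure ℝ :=
  (volume : Measure ℝ).tilted fun x => -γ * x ^ 2 / 2 - x ^ 4 / 12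

theorem measurable_magnetisation (n : ℕ) : Measurable (magnetisation n) := by
  unfold magnetisation; fun_prop

theorem ae_signLaw : ∀ᵐ x ∂signLaw, |x| ≤ 1 := by
  simp only [signLaw, bernoulliMeasure, ae_add_measure_iff]
  constructor <;>
    exact Measure.ae_smul_measure ((ae_dirac_iff (measurableSet_le (by fun_prop) (by fun_prop))).2
      (by simp)) _

instance (n : ℕ) (β : ℝ) : IsProbabilityMeasure (spinLaw n β) := by
  refine isProbabilityMeasure_tilted ?_
  have hm := measurable_magnetisation n
  refine Integrable.of_bound (C := Real.exp (|β / (2 * n)| * (n : ℝ) ^ 2))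
    (by fun_prop) ?_
  have h : ∀ᵐ x ∂(Measure.pi fun _ : Fin n => signLaw), ∀ i, |x i| ≤ 1 :=
    ae_all_iff.2 fun i =>
      (Measure.quasiMeasurePreserving_eval (fun _ : Fin n => signLaw) i).ae ae_signLaw
  filter_upwards [h] with x hx
  rw [Real.norm_eq_abs, Real.abs_exp, Real.exp_le_exp]
  have h1 : |magnetisation n x| ≤ n := by
    calc |magnetisation n x| ≤ ∑ k, |x k| := Finset.abs_sum_le_sum_abs _ _
      _ ≤ ∑ _k : Fin n, (1 : ℝ) := Finset.sum_le_sum fun k _ => hx k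
      _ = n := by simp
  have h2 : magnetisation n x ^ 2 ≤ (n : ℝ) ^ 2 := by
    rw [← sq_abs]; gcongr
  calc β / (2 * n) * magnetisation n x ^ 2
      ≤ |β / (2 * n)| * magnetisation n x ^ 2 := by gcongr; exact le_abs_self _
    _ ≤ _ := by gcongr

instance (γ : ℝ) : IsProbabilityMeasure (quarticLaw γ) := by
  refine isProbabilityMeasure_tilted ?_
  refine (((integrable_exp_neg_mul_sq one_pos).const_mul
    (Real.exp (3 * (1 - γ / 2) ^ 2)))).mono' (by fun_prop) (ae_of_all _ fun x => ?_)
  rw [Real.norm_eq_abs, Real.abs_exp, ← Real.exp_add, Real.exp_le_exp]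
  nlinarith [sq_nonneg (x ^ 2 / 6 - (1 - γ / 2))]

end CurieWeiss

end

open scoped Topology

namespace CurieWeiss

/-! A Gaussian integral in an auxiliary variable `z` linearises the interaction: `exp (β S² / (2n))`
becomes an average of `exp (c z S)`, under which the spins are independent. Hence the characteristic
function of `S / r` is a ratio of one-dimensional integrals of a Gaussian times `cosh ^ n`
(`charFun_map_magnetisation_div_eq_ratio`), and Lévy's continuity theorem reduces each regime to the
asymptotics of that ratio. The Fourier variable may enter inside `cosh` (parameter `e`) or as a
phase on the Gaussian (parameter `d`); the second choice keeps the weight real and costs only an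
explicit factor `exp κ`, with `κ → 0`.

For `β < 1`, `cosh (w / √n) ^ n → exp (w² / 2)`, leaving a Gaussian integral. In the critical window
the quadratic terms cancel up to the `γ` term, and `log cosh x - x² / 2 ∼ -x⁴ / 12` supplies the
quartic; `log_cosh_le` supplies the domination. For `β > 1` the weight is `exp (-n rate)`, and
Laplace's principle concentrates it at `±β t`, the two minimisers of the rate. Concavity of `tanh`
gives both the uniqueness of `t` and the shape of the rate. The Gamma representation of the quartic
law is the change of variables `g = x⁴ / 12`. -/

/-- The law of `n` independent symmetric signs. -/
noncomputable abbrev freeLaw (n : ℕ) : Measure (Fin n → ℝ) := Measure.pi fun _ : Fin n => signLaw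

/-! ### Gaussian linearisation and characteristic functions. -/

theorem integral_signLaw (f : ℝ → ℂ) : ∫ x, f x ∂signLaw = (f 1 + f (-1)) / 2 := by
  rw [signLaw, integral_bernoulliMeasure]
  simp only [Complex.real_smul]
  push_cast
  ring

theorem integral_cexp_mul_magnetisation (n : ℕ) (c : ℂ) :
    ∫ x, Complex.exp (c * magnetisation n x) ∂freeLaw n = Complex.cosh c ^ n := by
  have h : ∀ x : Fin n → ℝ,
      Complex.exp (c * magnetisation n x) = ∏ i, Complex.exp (c * (x i : ℂ)) := by
    intro x
    rw [magnetisation, ← Complex.exp_sum, Complex.ofReal_sum, Finset.mul_sum]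
  simp_rw [h]
  rw [integral_fintype_prod_eq_prod (fun _ (y : ℝ) => Complex.exp (c * (y : ℂ)))]
  simp [integral_signLaw, Complex.cosh, div_pow]

theorem ae_abs_magnetisation_le (n : ℕ) : ∀ᵐ x ∂freeLaw n, |magnetisation n x| ≤ n := by
  have h : ∀ᵐ x ∂freeLaw n, ∀ i, |x i| ≤ 1 :=
    ae_all_iff.2 fun i =>
      (Measure.quasiMeasurePreserving_eval (fun _ : Fin n => signLaw) i).ae ae_signLaw
  filter_upwards [h] with x hx
  calc |magnetisation n x| ≤ ∑ k, |x k| := Finset.abs_sum_le_sum_abs _ _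
    _ ≤ ∑ _k : Fin n, (1 : ℝ) := Finset.sum_le_sum fun k _ => hx k
    _ = n := by simp

/-- **Hubbard-Stratonovich transform**: a Gaussian integral linearises the square of the
magnetisation. -/
theorem integral_gaussian_mul_cosh_pow (n : ℕ) {a : ℝ} (ha : 0 < a) (c d e : ℂ) :
    ∫ z : ℝ, Complex.exp (-a * z ^ 2 + d * z) * Complex.cosh (c * z + e) ^ n =
      (Real.pi / a : ℂ) ^ (1 / 2 : ℂ) * ∫ x, Complex.exp
        ((c * magnetisation n x + d) ^ 2 / (4 * a) + e * magnetisation n x) ∂freeLaw n := by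
  have hm := measurable_magnetisation n
  have ha' : (a : ℂ) ≠ 0 := by exact_mod_cast ha.ne'
  have hint : Integrable (Function.uncurry fun (z : ℝ) (x : Fin n → ℝ) =>
      Complex.exp (-a * z ^ 2 + d * z) * Complex.exp ((c * z + e) * magnetisation n x))
      (volume.prod (freeLaw n)) := by
    -- Since `|S| ≤ n`, the terms added to `-a z²` grow at most linearly in `|z|`; half of the
    -- Gaussian absorbs them by completing the square.
    have hdom : Integrable (fun z : ℝ => Real.exp ((‖d‖ + ‖c‖ * n) ^ 2 / (2 * a) + ‖e‖ * n) *
        Real.exp (-(a / 2) * z ^ 2)) :=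
      (integrable_exp_neg_mul_sq (by positivity)).const_mul _
    refine (hdom.comp_fst (freeLaw n)).mono' (by fun_prop) ?_
    have hS : ∀ᵐ p ∂(volume : Measure ℝ).prod (freeLaw n), |magnetisation n p.2| ≤ n :=
      Measure.quasiMeasurePreserving_snd.ae (ae_abs_magnetisation_le n)
    filter_upwards [hS] with p hp
    obtain ⟨z, x⟩ := p
    simp only at hp
    simp only [Function.uncurry_apply_pair]
    rw [← Complex.exp_add, Complex.norm_exp, ← Real.exp_add, Real.exp_le_exp]
    have h1 : (-(a : ℂ) * z ^ 2 + d * z + (c * z + e) * magnetisation n x).re =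
        -a * z ^ 2 + (d * z + (c * z + e) * magnetisation n x).re := by
      rw [add_assoc, Complex.add_re]
      congr 1
      norm_cast
    have h2 : (d * z + (c * z + e) * magnetisation n x).re ≤
        ‖d‖ * |z| + (‖c‖ * |z| + ‖e‖) * n := by
      refine (Complex.re_le_norm _).trans ((norm_add_le _ _).trans ?_)
      rw [norm_mul, norm_mul, Complex.norm_real, Complex.norm_real, Real.norm_eq_abs,
        Real.norm_eq_abs]
      gcongr
      refine (norm_add_le _ _).trans ?_
      rw [norm_mul, Complex.norm_real, Real.norm_eq_abs]
    rw [h1]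
    have h3 : (‖d‖ + ‖c‖ * n) * |z| ≤ (‖d‖ + ‖c‖ * n) ^ 2 / (2 * a) + a / 2 * z ^ 2 := by
      have : (‖d‖ + ‖c‖ * n) ^ 2 / (2 * a) + a / 2 * z ^ 2 - (‖d‖ + ‖c‖ * n) * |z| =
          ((‖d‖ + ‖c‖ * n) - a * |z|) ^ 2 / (2 * a) := by
        rw [← sq_abs z]; field_simp; ring
      have : 0 ≤ ((‖d‖ + ‖c‖ * n) - a * |z|) ^ 2 / (2 * a) := by positivity
      linarith
    nlinarith
  calc ∫ z : ℝ, Complex.exp (-a * z ^ 2 + d * z) * Complex.cosh (c * z + e) ^ n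
      = ∫ z : ℝ, ∫ x, Complex.exp (-a * z ^ 2 + d * z) *
          Complex.exp ((c * z + e) * magnetisation n x) ∂freeLaw n := by
        simp_rw [integral_const_mul, integral_cexp_mul_magnetisation]
    _ = ∫ x, (∫ z : ℝ, Complex.exp (-a * z ^ 2 + d * z) *
          Complex.exp ((c * z + e) * magnetisation n x)) ∂freeLaw n :=
        integral_integral_swap hint
    _ = ∫ x, (Real.pi / a : ℂ) ^ (1 / 2 : ℂ) * Complex.exp
        ((c * magnetisation n x + d) ^ 2 / (4 * a) + e * magnetisation n x) ∂freeLaw n := by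
        congr 1
        ext x
        have h : ∀ z : ℝ, Complex.exp (-a * z ^ 2 + d * z) *
            Complex.exp ((c * z + e) * magnetisation n x) = Complex.exp (-a * z ^ 2 +
              (c * magnetisation n x + d) * z + e * magnetisation n x) := by
          intro z
          rw [← Complex.exp_add]
          ring_nf
        simp_rw [h]
        rw [integral_cexp_quadratic (by simpa using ha), neg_neg]
        congr 2
        field_simp
        ring
    _ = _ := integral_const_mul _ _

theorem charFun_map_magnetisation_div (n : ℕ) (β r ξ : ℝ) :
    charFun ((spinLaw n β).map fun x => magnetisation n x / r) ξ =
      (∫ x, Complex.exp (β / (2 * n) * magnetisation n x ^ 2 +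
          ξ / r * Complex.I * magnetisation n x) ∂freeLaw n) /
        ∫ x, Complex.exp (β / (2 * n) * magnetisation n x ^ 2) ∂freeLaw n := by
  have hm := measurable_magnetisation n
  rw [charFun_apply_real, integral_map (by fun_prop) (by fun_prop), spinLaw, integral_tilted]
  have h0 : ∫ x, Complex.exp (β / (2 * n) * magnetisation n x ^ 2) ∂freeLaw n =
      ((∫ x, Real.exp (β / (2 * n) * magnetisation n x ^ 2) ∂freeLaw n : ℝ) : ℂ) := by
    rw [← integral_complex_ofReal]
    push_cast
    rfl
  rw [h0, ← integral_div]
  congr 1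
  ext x
  rw [Complex.real_smul, Complex.exp_add]
  push_cast
  rw [div_mul_eq_mul_div]
  congr 3
  ring

/-- Lévy's continuity theorem, applied to the image laws on `ℝ` because the configuration space
itself changes with `n`. -/
theorem tendstoInDistribution_magnetisation_div {Ω : Type*} [MeasurableSpace Ω] {ν : Measure Ω}
    [IsProbabilityMeasure ν] {Z : Ω → ℝ} (hZ : Measurable Z) {β r : ℕ → ℝ}
    (h : ∀ ξ : ℝ, Tendsto
      (fun n => charFun ((spinLaw n (β n)).map fun x => magnetisation n x / r n) ξ) atTop
      (𝓝 (charFun (ν.map Z) ξ))) :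
    TendstoInDistribution (fun n x => magnetisation n x / r n) atTop Z
      (fun n => spinLaw n (β n)) ν where
  forall_aemeasurable n := ((measurable_magnetisation n).div_const _).aemeasurable
  aemeasurable_limit := hZ.aemeasurable
  tendsto := ProbabilityMeasure.tendsto_of_tendsto_charFun h

/-! ### Estimates for `tanh` and `log cosh`. -/

theorem hasDerivAt_tanh (x : ℝ) : HasDerivAt Real.tanh (1 - Real.tanh x ^ 2) x := by
  have h : HasDerivAt (fun y => Real.sinh y / Real.cosh y) _ x :=
    (Real.hasDerivAt_sinh x).div (Real.hasDerivAt_cosh x) (Real.cosh_pos x).ne'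
  have e : (fun y => Real.sinh y / Real.cosh y) = Real.tanh := by
    ext y; rw [Real.tanh_eq_sinh_div_cosh]
  rw [e] at h
  convert h using 1
  rw [Real.tanh_eq_sinh_div_cosh]
  have := (Real.cosh_pos x).ne'
  field_simp

theorem hasDerivAt_log_cosh (x : ℝ) :
    HasDerivAt (fun y => Real.log (Real.cosh y)) (Real.tanh x) x := by
  rw [Real.tanh_eq_sinh_div_cosh]
  exact (Real.hasDerivAt_cosh x).log (Real.cosh_pos x).ne'

/-- This is `exp (2x) ≥ 1 + 2x` inserted in `tanh x = (exp (2x) - 1) / (exp (2x) + 1)`. -/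
theorem div_one_add_le_tanh {x : ℝ} (hx : 0 ≤ x) : x / (1 + x) ≤ Real.tanh x := by
  have h1 : 1 + 2 * x ≤ Real.exp x * Real.exp x := by
    rw [← Real.exp_add]
    linarith [Real.add_one_le_exp (x + x)]
  have h2 : Real.exp x * Real.exp (-x) = 1 := by rw [← Real.exp_add]; simp
  have hp := Real.exp_pos x
  have hq := Real.exp_pos (-x)
  rw [Real.tanh_eq, div_le_div_iff₀ (by linarith) (by linarith)]
  have h4 : (1 + 2 * x) * Real.exp (-x) ≤ Real.exp x := by
    calc (1 + 2 * x) * Real.exp (-x) ≤ (Real.exp x * Real.exp x) * Real.exp (-x) := by gcongr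
      _ = Real.exp x := by rw [mul_assoc, h2, mul_one]
  nlinarith

/-- A function vanishing at `0` with nonnegative derivative on `[0, ∞)` is nonnegative there. -/
theorem nonneg_of_hasDerivAt_nonneg {f f' : ℝ → ℝ} (hf : ∀ x, HasDerivAt f (f' x) x)
    (h0 : f 0 = 0) (hf' : ∀ x, 0 ≤ x → 0 ≤ f' x) {x : ℝ} (hx : 0 ≤ x) : 0 ≤ f x := by
  have hmono : MonotoneOn f (Set.Ici 0) := by
    refine monotoneOn_of_deriv_nonneg (convex_Ici 0)
      (fun y _ => (hf y).continuousAt.continuousWithinAt)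
      (fun y _ => (hf y).differentiableAt.differentiableWithinAt) fun y hy => ?_
    rw [interior_Ici] at hy
    rw [(hf y).deriv]
    exact hf' y (le_of_lt hy)
  rw [← h0]
  exact hmono Set.self_mem_Ici hx hx

/-- The gain over `x² / 2` is quartic near `0` and quadratic at infinity, so it survives rescaling.
Differentiating twice reduces the claim to a rational lower bound for `tanh²`, which follows from
`div_one_add_le_tanh` and `(1 + y)² ≤ 2 (1 + y²)`. -/
theorem log_cosh_le (x : ℝ) :
    Real.log (Real.cosh x) ≤ x ^ 2 / 2 - x ^ 4 / (24 * (1 + x ^ 2)) := by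
  wlog hx : 0 ≤ x generalizing x
  · simpa [Even.neg_pow (by decide : Even 4)] using this (-x) (by linarith)
  have hd1 : ∀ y : ℝ, HasDerivAt (fun y : ℝ => 1 + y ^ 2) (2 * y) y := fun y => by
    simpa using (hasDerivAt_pow 2 y).const_add 1
  have hne : ∀ y : ℝ, (1 + y ^ 2) ≠ 0 := fun y => by positivity
  have hK' : ∀ y : ℝ, HasDerivAt (fun y : ℝ => y - Real.tanh y -
      (4 * y ^ 3 + 2 * y ^ 5) / (24 * (1 + y ^ 2) ^ 2))
      (Real.tanh y ^ 2 - (12 * y ^ 2 + 6 * y ^ 4 + 2 * y ^ 6) / (24 * (1 + y ^ 2) ^ 3)) y := by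
    intro y
    have h := ((hasDerivAt_id y).sub (hasDerivAt_tanh y)).sub
      (((hasDerivAt_pow 3 y).const_mul 4).add ((hasDerivAt_pow 5 y).const_mul 2) |>.div
        (((hd1 y).pow 2).const_mul 24) (by simp only [Pi.pow_apply]; positivity))
    refine h.congr_deriv ?_
    have := hne y
    simp only [Pi.add_apply, Pi.pow_apply]
    push_cast
    field_simp
    ring
  have hK : ∀ y : ℝ, HasDerivAt (fun y : ℝ => y ^ 2 / 2 - y ^ 4 / (24 * (1 + y ^ 2)) -
      Real.log (Real.cosh y))
      (y - Real.tanh y - (4 * y ^ 3 + 2 * y ^ 5) / (24 * (1 + y ^ 2) ^ 2)) y := by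
    intro y
    have h := (((hasDerivAt_pow 2 y).div_const 2).sub
      ((hasDerivAt_pow 4 y).div ((hd1 y).const_mul 24) (by have := hne y; positivity))).sub
      (hasDerivAt_log_cosh y)
    refine h.congr_deriv ?_
    have := hne y
    push_cast
    field_simp
    ring
  have hpos : ∀ y : ℝ, 0 ≤ y → 0 ≤ Real.tanh y ^ 2 -
      (12 * y ^ 2 + 6 * y ^ 4 + 2 * y ^ 6) / (24 * (1 + y ^ 2) ^ 3) := by
    intro y hy
    have h1 : (y / (1 + y)) ^ 2 ≤ Real.tanh y ^ 2 := by
      gcongr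
      exact div_one_add_le_tanh hy
    have h2 : y ^ 2 / (2 * (1 + y ^ 2)) ≤ (y / (1 + y)) ^ 2 := by
      rw [div_pow]
      gcongr
      nlinarith [sq_nonneg (y - 1)]
    have h3 : (12 * y ^ 2 + 6 * y ^ 4 + 2 * y ^ 6) / (24 * (1 + y ^ 2) ^ 3) ≤
        y ^ 2 / (2 * (1 + y ^ 2)) := by
      rw [div_le_div_iff₀ (by positivity) (by positivity)]
      have : y ^ 2 * (24 * (1 + y ^ 2) ^ 3) -
          (12 * y ^ 2 + 6 * y ^ 4 + 2 * y ^ 6) * (2 * (1 + y ^ 2)) =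
          y ^ 4 * (1 + y ^ 2) * (36 + 20 * y ^ 2) := by ring
      have : 0 ≤ y ^ 4 * (1 + y ^ 2) * (36 + 20 * y ^ 2) := by positivity
      linarith
    linarith
  have := nonneg_of_hasDerivAt_nonneg hK (by simp)
    (fun y hy => nonneg_of_hasDerivAt_nonneg hK' (by simp) hpos hy) hx
  linarith

theorem tendsto_log_cosh_sub_div_pow :
    Tendsto (fun x : ℝ => (Real.log (Real.cosh x) - x ^ 2 / 2) / x ^ 4) (𝓝[≠] 0)
      (𝓝 (-1 / 12)) := by
  have hne : ∀ᶠ x : ℝ in 𝓝[≠] 0, x ≠ 0 := eventually_mem_nhdsWithin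
  have ht : Tendsto (fun x : ℝ => Real.tanh x / x) (𝓝[≠] 0) (𝓝 1) := by
    have := (hasDerivAt_iff_tendsto_slope.1 (hasDerivAt_tanh 0))
    simpa [slope_fun_def_field] using this
  have hlim : ∀ {f : ℝ → ℝ}, ContinuousAt f 0 → f 0 = 0 → Tendsto f (𝓝[≠] 0) (𝓝 0) :=
    fun hf h0 => by
      have := hf.tendsto.mono_left (nhdsWithin_le_nhds (s := {(0 : ℝ)}ᶜ))
      rwa [h0] at this
  have hd1 : ∀ x, HasDerivAt (fun x => Real.tanh x - x) (-(Real.tanh x) ^ 2) x := fun x =>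
    ((hasDerivAt_tanh x).sub (hasDerivAt_id x)).congr_deriv (by ring)
  have hd0 : ∀ x, HasDerivAt (fun x => Real.log (Real.cosh x) - x ^ 2 / 2)
      (Real.tanh x - x) x := fun x =>
    ((hasDerivAt_log_cosh x).sub ((hasDerivAt_pow 2 x).div_const 2)).congr_deriv (by simp)
  have hg0 : ∀ x : ℝ, HasDerivAt (fun x : ℝ => x ^ 4) (4 * x ^ 3) x := fun x =>
    (hasDerivAt_pow 4 x).congr_deriv (by norm_num)
  have hg1 : ∀ x : ℝ, HasDerivAt (fun x : ℝ => 4 * x ^ 3) (12 * x ^ 2) x := fun x =>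
    ((hasDerivAt_pow 3 x).const_mul 4).congr_deriv (by norm_num; ring)
  -- Two rounds of l'Hôpital lead to `-tanh² x / (12 x²)`.
  refine HasDerivAt.lhopital_zero_nhdsNE (.of_forall hd0) (.of_forall hg0)
    (hne.mono fun x hx => by positivity) (hlim (hd0 0).continuousAt (by simp))
    (hlim (hg0 0).continuousAt (by simp)) ?_
  refine HasDerivAt.lhopital_zero_nhdsNE (.of_forall hd1) (.of_forall hg1)
    (hne.mono fun x hx => by positivity) (hlim (hd1 0).continuousAt (by simp))
    (hlim (hg1 0).continuousAt (by simp)) ?_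
  have := (ht.pow 2).mul_const (-1 / 12 : ℝ)
  rw [one_pow, one_mul] at this
  refine this.congr' (hne.mono fun x hx => ?_)
  field_simp

/-! ### The characteristic function as a ratio of one-dimensional integrals. -/

/-- `h1` matches the completed square with the tilted exponent, `-κ` being its constant term `d² /
(4a)`; `h0` does the same for the normalisation. The Gaussian prefactors cancel. -/
theorem charFun_map_magnetisation_div_eq_ratio {n : ℕ} {β r ξ a : ℝ} (ha : 0 < a)
    {c d e κ : ℂ} (h0 : ∀ s : ℂ, (c * s) ^ 2 / (4 * a) = β / (2 * n) * s ^ 2)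
    (h1 : ∀ s : ℂ, (c * s + d) ^ 2 / (4 * a) + e * s =
      β / (2 * n) * s ^ 2 + ξ / r * Complex.I * s - κ) :
    charFun ((spinLaw n β).map fun x => magnetisation n x / r) ξ =
      Complex.exp κ *
        ((∫ z : ℝ, Complex.exp (-a * z ^ 2 + d * z) * Complex.cosh (c * z + e) ^ n) /
          ∫ z : ℝ, Complex.exp (-a * z ^ 2) * Complex.cosh (c * z) ^ n) := by
  have hπ : (Real.pi / a : ℂ) ^ (1 / 2 : ℂ) ≠ 0 := by
    have : (a : ℂ) ≠ 0 := by exact_mod_cast ha.ne'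
    rw [Complex.cpow_ne_zero_iff_of_exponent_ne_zero (by norm_num)]
    exact div_ne_zero (by exact_mod_cast Real.pi_ne_zero) this
  have hd := integral_gaussian_mul_cosh_pow n ha c 0 0
  simp only [zero_mul, add_zero, h0] at hd
  rw [charFun_map_magnetisation_div, integral_gaussian_mul_cosh_pow n ha, hd,
    mul_div_mul_left _ _ hπ, ← mul_div_assoc, ← integral_const_mul]
  congr 2
  ext x
  rw [← Complex.exp_add, h1]
  ring_nf

/-! ### The subcritical regime. -/

theorem tendsto_cosh_div_sqrt_pow (w : ℂ) :
    Tendsto (fun n : ℕ => Complex.cosh (w / (√(n : ℝ) : ℝ)) ^ n) atTop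
      (𝓝 (Complex.exp (w ^ 2 / 2))) := by
  have hs : Tendsto (fun n : ℕ => (√(n : ℝ))⁻¹) atTop (𝓝[≠] 0) := by
    have : Tendsto (fun n : ℕ => √(n : ℝ)) atTop atTop :=
      Real.tendsto_sqrt_atTop.comp tendsto_natCast_atTop_atTop
    exact (tendsto_inv_atTop_nhdsGT_zero.comp this).mono_right
      (nhdsWithin_mono _ fun x hx => ne_of_gt hx)
  have hd : HasDerivAt (fun t : ℝ => Complex.sinh (t * (w / 2))) (w / 2) 0 := by
    have h1 : HasDerivAt (fun t : ℝ => (t : ℂ) * (w / 2)) (w / 2) 0 := by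
      simpa using (Complex.ofRealCLM.hasDerivAt (x := 0)).mul_const (w / 2)
    have h2 : HasDerivAt Complex.sinh 1 (((0 : ℝ) : ℂ) * (w / 2)) := by
      simpa using Complex.hasDerivAt_sinh 0
    exact (h2.comp (0 : ℝ) h1).congr_deriv (one_mul _)
  have hlim := (hasDerivAt_iff_tendsto_slope.1 hd).comp hs
  have hg : Tendsto (fun n : ℕ => (n : ℂ) * (Complex.cosh (w / (√(n : ℝ) : ℝ)) - 1)) atTop
      (𝓝 (w ^ 2 / 2)) := by
    have h2 := (hlim.pow 2).const_mul 2
    have e : (2 : ℂ) * (w / 2) ^ 2 = w ^ 2 / 2 := by ring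
    rw [e] at h2
    refine h2.congr fun n => ?_
    -- The half-angle formula turns the second-order expansion of `cosh` into the square of a
    -- first-order one, so the derivative of `sinh` at `0` suffices.
    have hc : Complex.cosh (w / (√(n : ℝ) : ℝ)) =
        1 + 2 * Complex.sinh ((√(n : ℝ))⁻¹ * (w / 2)) ^ 2 := by
      have := Complex.cosh_two_mul ((√(n : ℝ))⁻¹ * (w / 2))
      rw [Complex.cosh_sq] at this
      push_cast at this ⊢
      rw [show w / ((√(n : ℝ) : ℝ) : ℂ) = 2 * (((√(n : ℝ) : ℝ) : ℂ)⁻¹ * (w / 2)) by ring, this]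
      ring
    have hn : ((√(n : ℝ) : ℝ) : ℂ) ^ 2 = n := by
      rw [← Complex.ofReal_pow, Real.sq_sqrt (Nat.cast_nonneg n)]
      simp
    rw [hc, ← hn]
    simp only [Function.comp_apply, slope, vsub_eq_sub, Complex.real_smul]
    push_cast
    simp
    ring
  simpa using Complex.tendsto_one_add_pow_exp_of_tendsto hg

theorem norm_cosh_le (w : ℂ) : ‖Complex.cosh w‖ ≤ Real.exp (w.re ^ 2 / 2) := by
  refine le_trans ?_ (Real.cosh_le_exp_half_sq w.re)
  rw [Complex.cosh, norm_div, Real.cosh_eq, Complex.norm_ofNat]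
  gcongr
  refine (norm_add_le _ _).trans ?_
  simp [Complex.norm_exp]

/-- By `norm_cosh_le` the `n`-th power is at most `exp (b.re² z² / 2)` uniformly in `n`, which the
Gaussian beats exactly when `b.re² < 1`. -/
theorem tendsto_integral_gaussian_mul_cosh_pow {b : ℂ} (hb : b.re ^ 2 < 1) (ξ : ℝ) :
    Tendsto (fun n : ℕ => ∫ z : ℝ, Complex.exp (-(1 / 2 : ℝ) * z ^ 2) *
      Complex.cosh ((b * z + ξ * Complex.I) / (√(n : ℝ) : ℝ)) ^ n) atTop
      (𝓝 (∫ z : ℝ, Complex.exp (-(1 / 2 : ℝ) * z ^ 2) *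
        Complex.exp ((b * z + ξ * Complex.I) ^ 2 / 2))) := by
  refine tendsto_integral_of_dominated_convergence
    (fun z : ℝ => Real.exp (-((1 - b.re ^ 2) / 2) * z ^ 2)) (fun n => ?_)
    (integrable_exp_neg_mul_sq (by linarith)) (fun n => ?_) ?_
  · exact Continuous.aestronglyMeasurable (by fun_prop)
  · refine ae_of_all _ fun z => ?_
    rcases Nat.eq_zero_or_pos n with rfl | hn
    · simp only [pow_zero, mul_one, Complex.norm_exp, Real.exp_le_exp]
      have : (-((1 / 2 : ℝ) : ℂ) * z ^ 2).re = -(1 / 2) * z ^ 2 := by norm_cast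
      rw [this]
      nlinarith [mul_nonneg (sq_nonneg b.re) (sq_nonneg z)]
    have hn' : (0 : ℝ) < n := by exact_mod_cast hn
    have hre : ((b * z + ξ * Complex.I) / (√(n : ℝ) : ℝ)).re = b.re * z / √(n : ℝ) := by
      rw [Complex.div_ofReal_re]
      simp
    rw [norm_mul, norm_pow, Complex.norm_exp]
    calc _ ≤ Real.exp (-(1 / 2) * z ^ 2) * Real.exp ((b.re * z / √(n : ℝ)) ^ 2 / 2) ^ n := by
          gcongr
          · apply le_of_eq; norm_cast
          · rw [← hre]; exact norm_cosh_le _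
      _ = _ := by
          rw [← Real.exp_nat_mul, ← Real.exp_add, div_pow, Real.sq_sqrt hn'.le]
          congr 1
          field_simp
          ring
  · exact ae_of_all _ fun z => (tendsto_cosh_div_sqrt_pow _).const_mul _

theorem tendstoInDistribution_of_lt_one {β : ℝ} (hβ : β < 1) :
    TendstoInDistribution (fun n x => magnetisation n x / √(n : ℝ)) atTop (fun z : ℝ => z)
      (fun n => spinLaw n β) (gaussianReal 0 (1 / (1 - β)).toNNReal) := by
  refine tendstoInDistribution_magnetisation_div (β := fun _ => β) measurable_id fun ξ => ?_
  -- For negative `β` the root is imaginary; in all cases `b.re²` is `max β 0`.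
  obtain ⟨b, hb⟩ : ∃ b : ℂ, b ^ 2 = β := ⟨_, Complex.cpow_nat_inv_pow (β : ℂ) two_ne_zero⟩
  have hre : b.re ^ 2 < 1 := by
    have h1 := congrArg Complex.re hb
    have h2 := congrArg Complex.im hb
    simp only [sq, Complex.mul_re, Complex.mul_im, Complex.ofReal_re, Complex.ofReal_im] at h1 h2
    have h3 : b.re * b.im = 0 := by linarith
    rcases mul_eq_zero.1 h3 with h | h <;> simp only [h] at h1 ⊢ <;> nlinarith
  have hγ : ∀ ξ : ℝ, ∫ z : ℝ, Complex.exp (-(1 / 2 : ℝ) * z ^ 2) *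
      Complex.exp ((b * z + ξ * Complex.I) ^ 2 / 2) =
      (Real.pi / ((1 - β) / 2) : ℂ) ^ (1 / 2 : ℂ) *
        Complex.exp (-(1 / (1 - β)) * ξ ^ 2 / 2) := by
    intro ξ
    have h : ∀ z : ℝ, Complex.exp (-(1 / 2 : ℝ) * z ^ 2) *
        Complex.exp ((b * z + ξ * Complex.I) ^ 2 / 2) =
        Complex.exp (-((1 - β) / 2) * z ^ 2 + (b * ξ * Complex.I) * z + (-ξ ^ 2 / 2)) := by
      intro z
      rw [← Complex.exp_add, ← hb]
      congr 1
      push_cast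
      linear_combination (ξ ^ 2 / 2 : ℂ) * Complex.I_sq
    have h1β : (1 - β : ℂ) ≠ 0 := by
      have : (1 - β : ℝ) ≠ 0 := by linarith
      exact_mod_cast this
    simp_rw [h]
    rw [integral_cexp_quadratic, neg_neg]
    · congr 2
      field_simp
      rw [Complex.I_sq, hb]
      ring
    · have : (-((1 - (β : ℂ)) / 2)).re = -((1 - β) / 2) := by norm_cast
      rw [this]
      linarith
  have hlim := (tendsto_integral_gaussian_mul_cosh_pow hre ξ).div
    (tendsto_integral_gaussian_mul_cosh_pow hre 0) (by
      rw [hγ]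
      refine mul_ne_zero ?_ (Complex.exp_ne_zero _)
      rw [Complex.cpow_ne_zero_iff_of_exponent_ne_zero (by norm_num)]
      have : Real.pi / ((1 - β) / 2) ≠ 0 := (div_pos Real.pi_pos (by linarith)).ne'
      exact_mod_cast this)
  rw [hγ, hγ, mul_div_mul_left] at hlim
  swap
  · rw [Complex.cpow_ne_zero_iff_of_exponent_ne_zero (by norm_num)]
    have : Real.pi / ((1 - β) / 2) ≠ 0 := (div_pos Real.pi_pos (by linarith)).ne'
    exact_mod_cast this
  have hv : (((1 / (1 - β)).toNNReal : ℝ) : ℂ) = 1 / (1 - β) := by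
    rw [Real.coe_toNNReal _ (div_nonneg zero_le_one (by linarith))]
    push_cast
    rfl
  rw [Measure.map_id, charFun_gaussianReal, hv]
  refine (hlim.congr' ?_).trans (le_of_eq ?_)
  · filter_upwards [eventually_gt_atTop 0] with n hn
    have hn' : (n : ℂ) ≠ 0 := by exact_mod_cast hn.ne'
    have hsq : ((√(n : ℝ) : ℝ) : ℂ) ^ 2 = n := by
      rw [← Complex.ofReal_pow, Real.sq_sqrt (Nat.cast_nonneg n)]
      simp
    have hs0 : ((√(n : ℝ) : ℝ) : ℂ) ≠ 0 := fun h => hn' (by rw [← hsq, h]; simp)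
    rw [charFun_map_magnetisation_div_eq_ratio (a := 1 / 2) (c := b / (√(n : ℝ) : ℝ)) (d := 0)
      (e := ξ * Complex.I / (√(n : ℝ) : ℝ)) (κ := 0) (by norm_num)]
    · simp only [Complex.exp_zero, one_mul, zero_mul, add_zero, Pi.div_apply, Complex.ofReal_zero]
      congr 3 <;> ext z <;> congr 3 <;> ring
    · intro s
      rw [mul_pow, div_pow, hsq, hb]
      push_cast
      field_simp
      ring
    · intro s
      rw [add_zero, mul_pow, div_pow, hsq, hb]
      push_cast
      field_simp
      ring
  · congr 1
    simp
    ring_nf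

/-! ### The critical window. -/

theorem exp_mul_cosh_pow (n : ℕ) (a c x : ℝ) (d : ℂ) :
    Complex.exp (-a * x ^ 2 + d * x) * Complex.cosh (c * x) ^ n =
      Complex.exp (d * x) *
        (Real.exp (-a * x ^ 2 + n * Real.log (Real.cosh (c * x))) : ℝ) := by
  rw [Real.exp_add, Real.exp_nat_mul, Real.exp_log (Real.cosh_pos _), Complex.exp_add]
  push_cast
  ring

/-- The exponent of the density of the smoothed magnetisation in the critical window, for `n⁻¹ᐟ⁴`
equal to `h`. -/
noncomputable def windowExponent (γ h x : ℝ) : ℝ :=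
  (Real.log (Real.cosh (h * x)) - (h * x) ^ 2 / 2) / h ^ 4 - γ / (2 * (1 - γ * h ^ 2)) * x ^ 2

theorem tendsto_windowExponent (γ x : ℝ) :
    Tendsto (fun h => windowExponent γ h x) (𝓝[≠] 0) (𝓝 (-γ * x ^ 2 / 2 - x ^ 4 / 12)) := by
  have h1 : Tendsto (fun h : ℝ => (Real.log (Real.cosh (h * x)) - (h * x) ^ 2 / 2) / h ^ 4)
      (𝓝[≠] 0) (𝓝 (-1 / 12 * x ^ 4)) := by
    rcases eq_or_ne x 0 with rfl | hx
    · simp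
    have hmap : Tendsto (fun h : ℝ => h * x) (𝓝[≠] 0) (𝓝[≠] 0) := by
      refine tendsto_nhdsWithin_iff.2 ⟨?_, ?_⟩
      · have : Tendsto (fun h : ℝ => h * x) (𝓝 0) (𝓝 (0 * x)) :=
          (continuous_id.mul continuous_const).tendsto 0
        rw [zero_mul] at this
        exact this.mono_left nhdsWithin_le_nhds
      · filter_upwards [eventually_mem_nhdsWithin] with h hh
        exact mul_ne_zero hh hx
    refine ((tendsto_log_cosh_sub_div_pow.comp hmap).mul_const (x ^ 4)).congr' ?_
    filter_upwards [eventually_mem_nhdsWithin] with h hh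
    have hh' : h ≠ 0 := hh
    simp only [Function.comp_apply]
    field_simp
  have h2 : Tendsto (fun h : ℝ => γ / (2 * (1 - γ * h ^ 2)) * x ^ 2) (𝓝[≠] 0)
      (𝓝 (γ / (2 * (1 - γ * 0 ^ 2)) * x ^ 2)) := by
    have : ContinuousAt (fun h : ℝ => γ / (2 * (1 - γ * h ^ 2)) * x ^ 2) 0 := by
      refine ContinuousAt.mul (ContinuousAt.div (by fun_prop) (by fun_prop) (by norm_num))
        (by fun_prop)
    exact this.tendsto.mono_left nhdsWithin_le_nhds
  refine (h1.sub h2).trans (le_of_eq ?_)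
  congr 1
  ring

/-- A Gaussian bound uniform in `h`, whatever the sign of `γ`: the quartic gain of `log_cosh_le`
outweighs `|γ| x²`. -/
theorem windowExponent_le {γ h : ℝ} (h0 : h ≠ 0) (hh : (|γ| + 1) * h ^ 2 ≤ 1 / 48) (x : ℝ) :
    windowExponent γ h x ≤ 12 * (|γ| + 1) ^ 2 - x ^ 2 := by
  have hγ := abs_nonneg γ
  have hh2 : 0 < h ^ 2 := by positivity
  have hβ : 1 / 2 ≤ 1 - γ * h ^ 2 := by nlinarith [le_abs_self γ]
  have h1 : (Real.log (Real.cosh (h * x)) - (h * x) ^ 2 / 2) / h ^ 4 ≤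
      -(x ^ 4 / (24 * (1 + h ^ 2 * x ^ 2))) := by
    have := log_cosh_le (h * x)
    rw [div_le_iff₀ (by positivity)]
    calc _ ≤ -((h * x) ^ 4 / (24 * (1 + (h * x) ^ 2))) := by linarith
      _ = _ := by rw [mul_pow, mul_pow]; ring
  have h2 : -(γ / (2 * (1 - γ * h ^ 2))) ≤ |γ| := by
    rw [← neg_div, div_le_iff₀ (by linarith)]
    nlinarith [neg_abs_le γ]
  -- The constant `1 / 48` lets half of `x⁴` absorb the `h² x²` in the denominator; the other half
  -- completes the square `(x² - 24 (|γ| + 1))²`.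
  have h3 : (|γ| + 1) * x ^ 2 - 12 * (|γ| + 1) ^ 2 ≤ x ^ 4 / (24 * (1 + h ^ 2 * x ^ 2)) := by
    rw [le_div_iff₀ (by positivity)]
    have e1 : 0 ≤ (x ^ 2 - 24 * (|γ| + 1)) ^ 2 := sq_nonneg _
    have e2 : (|γ| + 1) * h ^ 2 * x ^ 4 ≤ 1 / 48 * x ^ 4 := by gcongr
    have e3 : 0 ≤ (|γ| + 1) ^ 2 * (h ^ 2 * x ^ 2) := by positivity
    nlinarith
  have h4 : -(γ / (2 * (1 - γ * h ^ 2))) * x ^ 2 ≤ |γ| * x ^ 2 := by gcongr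
  unfold windowExponent
  linarith

theorem tendsto_integral_windowExponent (γ ξ : ℝ) :
    Tendsto (fun h : ℝ => ∫ x : ℝ, Complex.exp (ξ / (1 - γ * h ^ 2) * Complex.I * x) *
        (Real.exp (windowExponent γ h x) : ℝ)) (𝓝[≠] 0)
      (𝓝 (∫ x : ℝ, Complex.exp (ξ * Complex.I * x) *
        (Real.exp (-γ * x ^ 2 / 2 - x ^ 4 / 12) : ℝ))) := by
  have hsmall : ∀ᶠ h : ℝ in 𝓝[≠] 0, (|γ| + 1) * h ^ 2 ≤ 1 / 48 := by
    have : Tendsto (fun h : ℝ => (|γ| + 1) * h ^ 2) (𝓝 0) (𝓝 ((|γ| + 1) * 0 ^ 2)) :=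
      Continuous.tendsto (by fun_prop) 0
    refine (this.mono_left nhdsWithin_le_nhds).eventually_le_const ?_
    norm_num
  refine tendsto_integral_filter_of_dominated_convergence
    (fun x : ℝ => Real.exp (12 * (|γ| + 1) ^ 2) * Real.exp (-1 * x ^ 2)) ?_ ?_
    ((integrable_exp_neg_mul_sq one_pos).const_mul _) ?_
  · refine .of_forall fun h => Continuous.aestronglyMeasurable ?_
    have : Continuous (windowExponent γ h) := by
      unfold windowExponent
      have : Continuous fun x : ℝ => Real.log (Real.cosh (h * x)) :=
        Continuous.log (by fun_prop) fun x => (Real.cosh_pos _).ne'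
      fun_prop
    fun_prop
  · filter_upwards [hsmall, eventually_mem_nhdsWithin] with h hh h0
    refine ae_of_all _ fun x => ?_
    have : ((ξ : ℂ) / (1 - γ * h ^ 2) * Complex.I * x) =
        ((ξ / (1 - γ * h ^ 2) * x : ℝ) : ℂ) * Complex.I := by push_cast; ring
    rw [norm_mul, this, Complex.norm_exp_ofReal_mul_I, one_mul, Complex.norm_real,
      Real.norm_eq_abs, Real.abs_exp, ← Real.exp_add, Real.exp_le_exp]
    linarith [windowExponent_le h0 hh x]
  · refine ae_of_all _ fun x => Tendsto.mul ?_ ?_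
    · have : ContinuousAt (fun h : ℝ =>
          Complex.exp (ξ / (1 - γ * h ^ 2) * Complex.I * x)) 0 := by
        refine ContinuousAt.cexp (ContinuousAt.mul (ContinuousAt.mul (ContinuousAt.div
          (by fun_prop) (by fun_prop) (by simp)) (by fun_prop)) (by fun_prop))
      simpa using this.tendsto.mono_left (nhdsWithin_le_nhds (s := {(0 : ℝ)}ᶜ))
    · exact (Complex.continuous_ofReal.tendsto _).comp
        ((Real.continuous_exp.tendsto _).comp (tendsto_windowExponent γ x))

theorem integrable_exp_quartic (γ : ℝ) :
    Integrable fun x : ℝ => Real.exp (-γ * x ^ 2 / 2 - x ^ 4 / 12) := by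
  refine (((integrable_exp_neg_mul_sq one_pos).const_mul
    (Real.exp (3 * (1 - γ / 2) ^ 2)))).mono' (by fun_prop) (ae_of_all _ fun x => ?_)
  rw [Real.norm_eq_abs, Real.abs_exp, ← Real.exp_add, Real.exp_le_exp]
  nlinarith [sq_nonneg (x ^ 2 / 6 - (1 - γ / 2))]

theorem charFun_quarticLaw (γ ξ : ℝ) :
    charFun (quarticLaw γ) ξ =
      (∫ x : ℝ, Complex.exp (ξ * Complex.I * x) *
        (Real.exp (-γ * x ^ 2 / 2 - x ^ 4 / 12) : ℝ)) /
      ∫ x : ℝ, ((Real.exp (-γ * x ^ 2 / 2 - x ^ 4 / 12) : ℝ) : ℂ) := by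
  rw [charFun_apply_real, quarticLaw, integral_tilted, integral_complex_ofReal, ← integral_div]
  congr 1
  ext x
  rw [Complex.real_smul]
  push_cast
  ring_nf

theorem tendstoInDistribution_critical_window (γ : ℝ) :
    TendstoInDistribution (fun n x => magnetisation n x / (n : ℝ) ^ (3 / 4 : ℝ)) atTop
      (fun z : ℝ => z) (fun n => spinLaw n (1 - γ / √(n : ℝ))) (quarticLaw γ) := by
  refine tendstoInDistribution_magnetisation_div (β := fun n : ℕ => 1 - γ / √(n : ℝ))
    (r := fun n : ℕ => (n : ℝ) ^ (3 / 4 : ℝ)) measurable_id fun ξ => ?_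
  rw [Measure.map_id, charFun_quarticLaw]
  have hs : Tendsto (fun n : ℕ => ((n : ℝ) ^ (1 / 4 : ℝ))⁻¹) atTop (𝓝[≠] 0) :=
    (tendsto_inv_atTop_nhdsGT_zero.comp ((tendsto_rpow_atTop (by norm_num)).comp
      tendsto_natCast_atTop_atTop)).mono_right (nhdsWithin_mono _ fun x hx => ne_of_gt hx)
  have hκ : Tendsto (fun h : ℝ => Complex.exp (ξ ^ 2 * h ^ 2 / (2 * (1 - γ * h ^ 2))))
      (𝓝[≠] 0) (𝓝 1) := by
    have : ContinuousAt (fun h : ℝ =>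
        Complex.exp (ξ ^ 2 * h ^ 2 / (2 * (1 - γ * h ^ 2)))) 0 :=
      ContinuousAt.cexp (ContinuousAt.div (by fun_prop) (by fun_prop) (by simp))
    simpa using this.tendsto.mono_left (nhdsWithin_le_nhds (s := {(0 : ℝ)}ᶜ))
  have h0 := tendsto_integral_windowExponent γ 0
  simp only [Complex.ofReal_zero, zero_div, zero_mul, Complex.exp_zero, one_mul] at h0
  have hlim := (hκ.mul ((tendsto_integral_windowExponent γ ξ).div h0 (by
    rw [integral_complex_ofReal]
    exact_mod_cast (integral_exp_pos (integrable_exp_quartic γ)).ne'))).comp hs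
  rw [one_mul] at hlim
  refine hlim.congr' ?_
  have hβev : ∀ᶠ h : ℝ in 𝓝[≠] 0, 0 < 1 - γ * h ^ 2 := by
    have : Tendsto (fun h : ℝ => 1 - γ * h ^ 2) (𝓝 0) (𝓝 (1 - γ * 0 ^ 2)) :=
      Continuous.tendsto (by fun_prop) 0
    exact (this.mono_left nhdsWithin_le_nhds).eventually_const_lt (by norm_num)
  filter_upwards [eventually_gt_atTop 0, hs.eventually hβev] with n hn hβ
  have hn' : (0 : ℝ) < n := by exact_mod_cast hn
  set h : ℝ := ((n : ℝ) ^ (1 / 4 : ℝ))⁻¹ with hh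
  have hpos : 0 < h := by positivity
  have hn4 : (n : ℝ) = (h ^ 4)⁻¹ := by
    rw [hh, inv_pow, inv_inv, ← Real.rpow_natCast, ← Real.rpow_mul hn'.le]
    norm_num
  have hsqrt : √(n : ℝ) = (h ^ 2)⁻¹ := by
    rw [hn4, Real.sqrt_eq_iff_mul_self_eq (by positivity) (by positivity)]
    field_simp
  have hr : (n : ℝ) ^ (3 / 4 : ℝ) = (h ^ 3)⁻¹ := by
    rw [hh, inv_pow, inv_inv, ← Real.rpow_natCast, ← Real.rpow_mul hn'.le]
    norm_num
  have hnC : (n : ℂ) = ((h : ℂ) ^ 4)⁻¹ := by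
    rw [← Complex.ofReal_natCast, hn4]; push_cast; rfl
  have hβC : (1 - γ * (h : ℂ) ^ 2) ≠ 0 := by exact_mod_cast hβ.ne'
  have hhC : (h : ℂ) ≠ 0 := by exact_mod_cast hpos.ne'
  have hexp : ∀ x : ℝ, -(1 / (2 * (1 - γ * h ^ 2) * h ^ 2)) * x ^ 2 +
      n * Real.log (Real.cosh (h * x)) = windowExponent γ h x := by
    intro x
    have := hβ.ne'
    rw [windowExponent, hn4]
    field_simp
    ring
  -- With `n = h⁻⁴` and `b = 1 - γ h²`, the choice `c = h` forces `a` through `c² / (4a) = b /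
  -- (2n)`; then `2cd / (4a) = i ξ h³` forces `d`, and `κ = -d² / (4a)`.
  rw [hsqrt, hr, div_inv_eq_mul, charFun_map_magnetisation_div_eq_ratio
    (a := 1 / (2 * (1 - γ * h ^ 2) * h ^ 2)) (c := h) (d := ξ / (1 - γ * h ^ 2) * Complex.I)
    (e := 0) (κ := ξ ^ 2 * h ^ 2 / (2 * (1 - γ * h ^ 2))) (by positivity)]
  · have h1 := fun x => exp_mul_cosh_pow n (1 / (2 * (1 - γ * h ^ 2) * h ^ 2)) h x 0
    have h2 := fun x => exp_mul_cosh_pow n (1 / (2 * (1 - γ * h ^ 2) * h ^ 2)) h x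
      (ξ / (1 - γ * h ^ 2) * Complex.I)
    simp only [hexp, zero_mul, add_zero, Complex.exp_zero, one_mul] at h1 h2
    simp only [add_zero, h1, h2]
    rfl
  · intro s
    rw [hnC]
    push_cast
    field_simp
    ring
  · intro s
    rw [hnC]
    push_cast
    generalize (1 - γ * (h : ℂ) ^ 2) = b at hβC
    field_simp
    ring_nf
    simp only [Complex.I_sq]
    ring

/-! ### The equation `t = tanh (β t)`. -/

theorem strictMono_tanh : StrictMono Real.tanh :=
  strictMono_of_deriv_pos fun x => by
    rw [(hasDerivAt_tanh x).deriv, sub_pos]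
    exact (sq_lt_one_iff_abs_lt_one _).2 (Real.abs_tanh_lt_one x)

theorem strictConcaveOn_tanh : StrictConcaveOn ℝ (Set.Ici 0) Real.tanh := by
  refine StrictAntiOn.strictConcaveOn_of_deriv (convex_Ici 0)
    (fun y _ => (hasDerivAt_tanh y).continuousAt.continuousWithinAt) ?_
  intro x hx y _ hxy
  rw [interior_Ici] at hx
  rw [(hasDerivAt_tanh x).deriv, (hasDerivAt_tanh y).deriv]
  have h0 : 0 < Real.tanh x := by simpa using strictMono_tanh hx
  have h1 := strictMono_tanh hxy
  nlinarith

/-- `tanh x / x` is strictly decreasing, as `tanh` is strictly concave and vanishes at `0`. -/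
theorem mul_tanh_lt_mul_tanh {x y : ℝ} (hx : 0 < x) (hxy : x < y) :
    x * Real.tanh y < y * Real.tanh x := by
  have hy : 0 < y := hx.trans hxy
  have h := strictConcaveOn_tanh.2 (Set.self_mem_Ici) (Set.mem_Ici.2 hy.le) hy.ne
    (sub_pos.2 ((div_lt_one hy).2 hxy)) (div_pos hx hy) (sub_add_cancel _ _)
  simp only [smul_eq_mul, mul_zero, Real.tanh_zero, zero_add, div_mul_cancel₀ _ hy.ne'] at h
  rw [div_mul_eq_mul_div, div_lt_iff₀ hy] at h
  linarith

theorem exists_pos_eq_tanh {β : ℝ} (hβ : 1 < β) : ∃ t : ℝ, 0 < t ∧ t = Real.tanh (β * t) := by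
  have hβ0 : 0 < β := by linarith
  have hs0 : 0 < (β - 1) / (2 * β) := div_pos (by linarith) (by linarith)
  have hs1 : (β - 1) / (2 * β) ≤ 1 := by rw [div_le_one (by linarith)]; linarith
  have hcont : ContinuousOn (fun s => Real.tanh (β * s) - s) (Set.Icc ((β - 1) / (2 * β)) 1) := by
    have : Continuous Real.tanh :=
      continuous_iff_continuousAt.2 fun x => (hasDerivAt_tanh x).continuousAt
    fun_prop
  -- At this endpoint `β s = (β - 1) / 2`, and the lower bound for `tanh` gives `(β - 1) / (β + 1) ≥
  -- (β - 1) / (2β)`.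
  have hl : 0 ≤ Real.tanh (β * ((β - 1) / (2 * β))) - (β - 1) / (2 * β) := by
    refine sub_nonneg.2 (le_trans ?_ (div_one_add_le_tanh (by positivity)))
    have e : β * ((β - 1) / (2 * β)) = (β - 1) / 2 := by field_simp
    rw [e, div_le_div_iff₀ (by linarith) (by linarith)]
    nlinarith
  have hr : Real.tanh (β * 1) - 1 ≤ 0 := by linarith [Real.tanh_lt_one (β * 1)]
  obtain ⟨t, ht, h⟩ := intermediate_value_Icc' hs1 hcont ⟨hr, hl⟩
  exact ⟨t, hs0.trans_le ht.1, by simp only at h; linarith⟩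

theorem eq_of_eq_tanh {β s t : ℝ} (hβ : 0 < β) (hs0 : 0 < s) (hs : s = Real.tanh (β * s))
    (ht0 : 0 < t) (ht : t = Real.tanh (β * t)) : s = t := by
  rcases lt_trichotomy s t with h | h | h
  · have := mul_tanh_lt_mul_tanh (mul_pos hβ hs0) (mul_lt_mul_of_pos_left h hβ)
    rw [← hs, ← ht] at this
    nlinarith
  · exact h
  · have := mul_tanh_lt_mul_tanh (mul_pos hβ ht0) (mul_lt_mul_of_pos_left h hβ)
    rw [← hs, ← ht] at this
    nlinarith

/-! ### Laplace asymptotics and the supercritical regime. -/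

/-- **Laplace's principle**: the measures with density proportional to `exp (-n Ψ)` charge, as
`n → ∞`, only the neighbourhoods of the zeros of `Ψ`. -/
theorem tendsto_laplace_ratio {Ψ : ℝ → ℝ} (hΨ : Continuous Ψ) (hnonneg : ∀ y, 0 ≤ Ψ y) {x₀ : ℝ}
    (hx₀ : Ψ x₀ = 0) (hint : Integrable fun y => Real.exp (-Ψ y)) {g : ℝ → ℝ}
    {C : ℝ} (hC : ∀ y, |g y| ≤ C)
    (hsep : ∀ ε > 0, ∃ δ > 0, ∀ y, ε < |g y| → δ ≤ Ψ y) :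
    Tendsto (fun n : ℕ => (∫ y, g y * Real.exp (-(n * Ψ y))) / ∫ y, Real.exp (-(n * Ψ y))) atTop
      (𝓝 0) := by
  have hC0 : 0 ≤ C := (abs_nonneg _).trans (hC 0)
  have hintn : ∀ n : ℕ, 0 < n → Integrable fun y => Real.exp (-(n * Ψ y)) := by
    intro n hn
    refine hint.mono' (by fun_prop) (ae_of_all _ fun y => ?_)
    rw [Real.norm_eq_abs, Real.abs_exp, Real.exp_le_exp]
    have : (1 : ℝ) ≤ n := by exact_mod_cast hn
    nlinarith [hnonneg y]
  set K := ∫ y, Real.exp (-Ψ y) with hK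
  have hK0 : 0 ≤ K := integral_nonneg fun y => (Real.exp_pos _).le
  rw [Metric.tendsto_atTop']
  intro ε hε
  obtain ⟨δ, hδ, hsepδ⟩ := hsep (ε / 2) (by linarith)
  -- The level `δ / 2` makes the denominator at least of order `exp (-n δ / 2)`, while the set where
  -- `|g| > ε / 2` contributes at most order `exp (-n δ)`.
  obtain ⟨η, hη, hball⟩ : ∃ η > 0, ∀ y ∈ Set.Ioo (x₀ - η) (x₀ + η), Ψ y < δ / 2 := by
    have : ∀ᶠ y in 𝓝 x₀, Ψ y < δ / 2 :=
      hΨ.continuousAt.eventually_lt continuousAt_const (by rw [hx₀]; linarith)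
    obtain ⟨η, hη, h⟩ := Metric.eventually_nhds_iff_ball.1 this
    exact ⟨η, hη, fun y hy => h y (by rwa [Real.ball_eq_Ioo])⟩
  have hdecay : Tendsto (fun n : ℕ => C * K * Real.exp δ / (2 * η) * Real.exp (-(δ / 2) * n))
      atTop (𝓝 0) := by
    have h1 : Tendsto (fun n : ℕ => Real.exp (-(δ / 2) * n)) atTop (𝓝 0) :=
      Real.tendsto_exp_atBot.comp
        (tendsto_natCast_atTop_atTop.const_mul_atTop_of_neg (by linarith))
    simpa using h1.const_mul (C * K * Real.exp δ / (2 * η))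
  obtain ⟨N, hN⟩ := eventually_atTop.1 (hdecay.eventually_lt_const (half_pos hε))
  refine ⟨N, fun n hn => ?_⟩
  have hn0 : 0 < n := (Nat.zero_le N).trans_lt hn
  have hlow : 2 * η * Real.exp (-(δ / 2) * n) ≤ ∫ y, Real.exp (-(n * Ψ y)) := by
    calc 2 * η * Real.exp (-(δ / 2) * n)
        = ∫ _y in Set.Ioo (x₀ - η) (x₀ + η), Real.exp (-(δ / 2) * n) := by
          rw [setIntegral_const, smul_eq_mul, Real.volume_real_Ioo_of_le (by linarith)]
          ring
      _ ≤ ∫ y in Set.Ioo (x₀ - η) (x₀ + η), Real.exp (-(n * Ψ y)) := by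
          refine setIntegral_mono_on (by simp) (hintn n hn0).integrableOn measurableSet_Ioo
            fun y hy => ?_
          rw [Real.exp_le_exp]
          have : (0 : ℝ) ≤ n := Nat.cast_nonneg n
          nlinarith [hball y hy]
      _ ≤ _ := setIntegral_le_integral (hintn n hn0) (ae_of_all _ fun y => (Real.exp_pos _).le)
  have hZ : 0 < ∫ y, Real.exp (-(n * Ψ y)) := lt_of_lt_of_le (by positivity) hlow
  have hup : |∫ y, g y * Real.exp (-(n * Ψ y))| ≤
      ε / 2 * (∫ y, Real.exp (-(n * Ψ y))) + C * Real.exp (-((n - 1) * δ)) * K := by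
    rw [hK, ← integral_const_mul, ← integral_const_mul, ← integral_add
      ((hintn n hn0).const_mul _) (hint.const_mul _), ← Real.norm_eq_abs]
    refine norm_integral_le_of_norm_le (((hintn n hn0).const_mul _).add (hint.const_mul _))
      (ae_of_all _ fun y => ?_)
    rw [norm_mul, Real.norm_eq_abs, Real.norm_eq_abs, Real.abs_exp]
    have hp1 := Real.exp_pos (-(n * Ψ y))
    rcases le_or_gt |g y| (ε / 2) with h | h
    · have : 0 ≤ C * Real.exp (-((n - 1) * δ)) * Real.exp (-Ψ y) := by positivity
      nlinarith
    · have hn1 : (1 : ℝ) ≤ n := by exact_mod_cast hn0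
      -- One factor `exp (-Ψ)` is kept for integrability; the other `n - 1` give the decay.
      have h2 : Real.exp (-(n * Ψ y)) ≤ Real.exp (-((n - 1) * δ)) * Real.exp (-Ψ y) := by
        rw [← Real.exp_add, Real.exp_le_exp]
        nlinarith [hsepδ y h]
      have h3 : |g y| * Real.exp (-(n * Ψ y)) ≤
          C * (Real.exp (-((n - 1) * δ)) * Real.exp (-Ψ y)) :=
        mul_le_mul (hC y) h2 hp1.le hC0
      nlinarith
  rw [dist_zero_right, Real.norm_eq_abs, abs_div, abs_of_pos hZ, div_lt_iff₀ hZ]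
  have hmain : C * Real.exp (-((n - 1) * δ)) * K < ε / 2 * ∫ y, Real.exp (-(n * Ψ y)) := by
    calc C * Real.exp (-((n - 1) * δ)) * K
        = C * K * Real.exp δ / (2 * η) * Real.exp (-(δ / 2) * n) *
            (2 * η * Real.exp (-(δ / 2) * n)) := by
          have : Real.exp (-((n - 1) * δ)) =
              Real.exp δ * Real.exp (-(δ / 2) * n) * Real.exp (-(δ / 2) * n) := by
            rw [← Real.exp_add, ← Real.exp_add]
            congr 1
            ring
          rw [this]
          field_simp
      _ < ε / 2 * (2 * η * Real.exp (-(δ / 2) * n)) := by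
          gcongr
          exact hN n hn.le
      _ ≤ _ := by gcongr
  linarith

/-- The rate function of the smoothed magnetisation at inverse temperature `β`. -/
noncomputable def rate (β u : ℝ) : ℝ := u ^ 2 / (2 * β) - Real.log (Real.cosh u)

theorem hasDerivAt_rate (β u : ℝ) : HasDerivAt (rate β) (u / β - Real.tanh u) u :=
  (((hasDerivAt_pow 2 u).div_const (2 * β)).sub (hasDerivAt_log_cosh u)).congr_deriv (by
    rw [Nat.cast_ofNat, Nat.add_one_sub_one, pow_one, mul_div_mul_left _ _ two_ne_zero])

theorem continuous_rate (β : ℝ) : Continuous (rate β) :=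
  continuous_iff_continuousAt.2 fun u => (hasDerivAt_rate β u).continuousAt

theorem rate_abs (β u : ℝ) : rate β |u| = rate β u := by
  rw [rate, rate, sq_abs, Real.cosh_abs]

theorem integrable_exp_neg_rate {β : ℝ} (hβ : 0 < β) :
    Integrable fun u => Real.exp (-rate β u) := by
  have hc := continuous_rate β
  refine ((integrable_exp_neg_mul_sq (b := 1 / (4 * β)) (by positivity)).const_mul
    (Real.exp β)).mono' (by fun_prop) (ae_of_all _ fun u => ?_)
  rw [Real.norm_eq_abs, Real.abs_exp, ← Real.exp_add, Real.exp_le_exp]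
  have h1 : Real.log (Real.cosh u) ≤ |u| := by
    rw [Real.log_le_iff_le_exp (Real.cosh_pos u), ← Real.cosh_abs, Real.cosh_eq]
    linarith [Real.exp_le_exp.2 (neg_le_self (abs_nonneg u))]
  have h2 : u ^ 2 / (2 * β) - |u| + β - 1 / (4 * β) * u ^ 2 =
      (|u| - 2 * β) ^ 2 / (4 * β) := by
    rw [← sq_abs u]; field_simp; ring
  have h3 : 0 ≤ (|u| - 2 * β) ^ 2 / (4 * β) := by positivity
  rw [rate]
  linarith

/-- The derivative `u / β - tanh u` changes sign where the decreasing `tanh u / u` equals `1 / β`,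
namely at `β t`. -/
theorem strictAntiOn_rate {β t : ℝ} (hβ : 0 < β) (ht : t = Real.tanh (β * t)) :
    StrictAntiOn (rate β) (Set.Icc 0 (β * t)) := by
  refine strictAntiOn_of_deriv_neg (convex_Icc _ _) (continuous_rate β).continuousOn
    fun u hu => ?_
  rw [interior_Icc] at hu
  rw [(hasDerivAt_rate β u).deriv, sub_neg, div_lt_iff₀ hβ]
  have h := mul_tanh_lt_mul_tanh hu.1 hu.2
  rw [← ht] at h
  have ht0 : 0 < t := pos_of_mul_pos_right (hu.1.trans hu.2) hβ.le
  nlinarith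

theorem strictMonoOn_rate {β t : ℝ} (hβ : 0 < β) (ht0 : 0 < t) (ht : t = Real.tanh (β * t)) :
    StrictMonoOn (rate β) (Set.Ici (β * t)) := by
  refine strictMonoOn_of_deriv_pos (convex_Ici _) (continuous_rate β).continuousOn
    fun u hu => ?_
  rw [interior_Ici] at hu
  rw [(hasDerivAt_rate β u).deriv, sub_pos, lt_div_iff₀ hβ]
  have h := mul_tanh_lt_mul_tanh (mul_pos hβ ht0) hu
  rw [← ht] at h
  nlinarith

theorem exists_rate_gap {β t r : ℝ} (hβ : 0 < β) (ht0 : 0 < t) (ht : t = Real.tanh (β * t))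
    (hr : 0 < r) : ∃ δ > 0, ∀ u, r ≤ |(|u| - β * t)| → δ ≤ rate β u - rate β (β * t) := by
  have hτ : 0 < β * t := mul_pos hβ ht0
  have hanti := strictAntiOn_rate hβ ht
  have hmono := strictMonoOn_rate hβ ht0 ht
  -- Truncating `r` keeps `β t - ρ` inside the interval where the rate decreases.
  set ρ := min r (β * t) with hρ
  have hρ0 : 0 < ρ := lt_min hr hτ
  have hρτ : ρ ≤ β * t := min_le_right _ _
  have hρr : ρ ≤ r := min_le_left _ _
  have h1 : rate β (β * t) < rate β (β * t - ρ) :=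
    hanti ⟨by linarith, by linarith⟩ ⟨hτ.le, le_rfl⟩ (by linarith)
  have h2 : rate β (β * t) < rate β (β * t + ρ) :=
    hmono Set.self_mem_Ici (Set.mem_Ici.2 (by linarith)) (by linarith)
  refine ⟨min (rate β (β * t - ρ) - rate β (β * t)) (rate β (β * t + ρ) - rate β (β * t)),
    lt_min (by linarith) (by linarith), fun u hu => ?_⟩
  rw [← rate_abs β u]
  rcases le_abs'.1 hu with h | h
  · refine (min_le_left _ _).trans (sub_le_sub_right ?_ _)
    exact hanti.antitoneOn ⟨abs_nonneg u, by linarith⟩ ⟨by linarith, by linarith⟩ (by linarith)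
  · refine (min_le_right _ _).trans (sub_le_sub_right ?_ _)
    exact hmono.monotoneOn (Set.mem_Ici.2 (by linarith)) (Set.mem_Ici.2 (by linarith))
      (by linarith)

theorem rate_min_le {β t : ℝ} (hβ : 0 < β) (ht0 : 0 < t) (ht : t = Real.tanh (β * t)) (u : ℝ) :
    rate β (β * t) ≤ rate β u := by
  rw [← rate_abs β u]
  rcases le_total |u| (β * t) with h | h
  · exact (strictAntiOn_rate hβ ht).antitoneOn ⟨abs_nonneg u, h⟩
      ⟨(mul_pos hβ ht0).le, le_rfl⟩ h
  · exact (strictMonoOn_rate hβ ht0 ht).monotoneOn Set.self_mem_Ici h h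

/-- The cosine is even, so it takes the same value at both minimisers `±β t`, and Laplace's
principle applies to the difference with that value. -/
theorem tendsto_integral_cos_rate {β t : ℝ} (hβ : 0 < β) (ht0 : 0 < t)
    (ht : t = Real.tanh (β * t)) (ω : ℝ) :
    Tendsto (fun n : ℕ => (∫ u, Real.cos (ω * u) * Real.exp (-(n * rate β u))) /
      ∫ u, Real.exp (-(n * rate β u))) atTop (𝓝 (Real.cos (ω * (β * t)))) := by
  set m := rate β (β * t) with hm
  have hc := continuous_rate β
  have hint : Integrable fun u => Real.exp (-(rate β u - m)) := by
    refine ((integrable_exp_neg_rate hβ).const_mul (Real.exp m)).congr (ae_of_all _ fun u => ?_)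
    simp only
    rw [← Real.exp_add]
    ring_nf
  have hlap := tendsto_laplace_ratio (Ψ := fun u => rate β u - m) (by fun_prop)
    (fun u => sub_nonneg.2 (rate_min_le hβ ht0 ht u)) (x₀ := β * t) (sub_self _) hint
    (g := fun u => Real.cos (ω * u) - Real.cos (ω * (β * t))) (C := 2)
    (fun u => (abs_sub _ _).trans (by
      linarith [Real.abs_cos_le_one (ω * u), Real.abs_cos_le_one (ω * (β * t))]))
    (fun ε hε => by
      obtain ⟨δ, hδ, h⟩ := exists_rate_gap hβ ht0 ht (r := ε / (|ω| + 1)) (by positivity)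
      refine ⟨δ, hδ, fun u hu => h u ?_⟩
      rw [div_le_iff₀ (by positivity)]
      have h1 : Real.cos (ω * u) = Real.cos (ω * |u|) := by
        rcases abs_choice u with h | h <;> rw [h]
        rw [mul_neg, Real.cos_neg]
      rw [h1] at hu
      have h2 := Real.abs_cos_sub_cos_le (ω * |u|) (ω * (β * t))
      rw [← mul_sub, abs_mul] at h2
      nlinarith [abs_nonneg (|u| - β * t)])
  have hlim := hlap.add_const (Real.cos (ω * (β * t)))
  rw [zero_add] at hlim
  refine hlim.congr' ?_
  filter_upwards [eventually_gt_atTop 0] with n hn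
  have hfac : ∀ u, Real.exp (-(n * rate β u)) =
      Real.exp (-(n * m)) * Real.exp (-(n * (rate β u - m))) := by
    intro u
    rw [← Real.exp_add]
    ring_nf
  have hintn : Integrable fun u => Real.exp (-(n * (rate β u - m))) := by
    refine hint.mono' (by fun_prop) (ae_of_all _ fun y => ?_)
    rw [Real.norm_eq_abs, Real.abs_exp, Real.exp_le_exp]
    have : (1 : ℝ) ≤ n := by exact_mod_cast hn
    nlinarith [rate_min_le hβ ht0 ht y]
  have hpos := (integral_exp_pos hintn).ne'
  have hintcos : Integrable fun u => Real.cos (ω * u) * Real.exp (-(n * (rate β u - m))) :=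
    hintn.bdd_mul (c := 1) (by fun_prop) (ae_of_all _ fun u => Real.abs_cos_le_one _)
  simp_rw [hfac, sub_mul, mul_left_comm _ (Real.exp (-(n * m)))]
  rw [integral_const_mul, integral_const_mul, mul_div_mul_left _ _ (Real.exp_ne_zero _),
    integral_sub hintcos (hintn.const_mul _), integral_const_mul]
  field_simp
  ring

/-- The sine part is odd: averaging the integrals for `ω` and `-ω` leaves the cosine. -/
theorem integral_cexp_mul_even {w : ℝ → ℝ} (hw : Integrable w) (heven : ∀ u, w (-u) = w u)
    (ω : ℝ) : ∫ u : ℝ, Complex.exp (ω * Complex.I * u) * (w u : ℂ) =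
      ((∫ u : ℝ, Real.cos (ω * u) * w u : ℝ) : ℂ) := by
  have hi : ∀ ω : ℝ, Integrable fun u : ℝ => Complex.exp (ω * Complex.I * u) * (w u : ℂ) :=
    fun ω => hw.ofReal.bdd_mul (c := 1) (by fun_prop) (ae_of_all _ fun u => by
      rw [show (ω : ℂ) * Complex.I * u = ((ω * u : ℝ) : ℂ) * Complex.I by push_cast; ring,
        Complex.norm_exp_ofReal_mul_I])
  have hneg : ∫ u : ℝ, Complex.exp (((-ω : ℝ) : ℂ) * Complex.I * u) * (w u : ℂ) =
      ∫ u : ℝ, Complex.exp (ω * Complex.I * u) * (w u : ℂ) := by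
    rw [← integral_neg_eq_self]
    congr 1
    ext u
    rw [heven]
    push_cast
    ring_nf
  have hsum := integral_add (hi ω) (hi (-ω))
  rw [hneg, ← two_mul] at hsum
  rw [← integral_complex_ofReal, ← mul_right_inj' (two_ne_zero (α := ℂ)), ← hsum,
    ← integral_const_mul]
  congr 1
  ext u
  push_cast
  rw [Complex.cos]
  ring_nf

theorem charFun_map_mul_signLaw (t ξ : ℝ) :
    charFun (signLaw.map fun b => t * b) ξ = ((Real.cos (ξ * t) : ℝ) : ℂ) := by
  rw [charFun_map_mul, charFun_apply_real, integral_signLaw]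
  push_cast
  rw [Complex.cos]
  ring_nf

theorem tendstoInDistribution_of_eq_tanh {β t : ℝ} (hβ : 0 < β) (ht0 : 0 < t)
    (ht : t = Real.tanh (β * t)) :
    TendstoInDistribution (fun n x => magnetisation n x / (n : ℝ)) atTop (fun b : ℝ => t * b)
      (fun n => spinLaw n β) signLaw := by
  refine tendstoInDistribution_magnetisation_div (β := fun _ => β) (r := fun n : ℕ => (n : ℝ))
    (by fun_prop) fun ξ => ?_
  rw [charFun_map_mul_signLaw]
  have hκ : Tendsto (fun n : ℕ => Complex.exp ((ξ ^ 2 / (2 * β) / n : ℝ) : ℂ)) atTop (𝓝 1) := by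
    have h1 := tendsto_const_div_atTop_nhds_zero_nat (ξ ^ 2 / (2 * β))
    simpa using ((Complex.continuous_ofReal.tendsto 0).comp h1).cexp
  have hcos := (Complex.continuous_ofReal.tendsto _).comp
    (tendsto_integral_cos_rate hβ ht0 ht (ξ / β))
  have hlim := hκ.mul hcos
  have e : ξ / β * (β * t) = ξ * t := by field_simp
  rw [one_mul, e] at hlim
  refine hlim.congr' ?_
  filter_upwards [eventually_gt_atTop 0] with n hn
  have hn' : (0 : ℝ) < n := by exact_mod_cast hn
  have hnC : (n : ℂ) ≠ 0 := by exact_mod_cast hn.ne'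
  have hβC : (β : ℂ) ≠ 0 := by exact_mod_cast hβ.ne'
  have hc := continuous_rate β
  have hint : Integrable fun u => Real.exp (-(n * rate β u)) := by
    refine ((integrable_exp_neg_rate hβ).const_mul
      (Real.exp (-((n - 1) * rate β (β * t))))).mono' (by fun_prop) (ae_of_all _ fun u => ?_)
    rw [Real.norm_eq_abs, Real.abs_exp, ← Real.exp_add, Real.exp_le_exp]
    have : (1 : ℝ) ≤ n := by exact_mod_cast hn
    nlinarith [rate_min_le hβ ht0 ht u]
  have hexp : ∀ x : ℝ, -(n / (2 * β)) * x ^ 2 + n * Real.log (Real.cosh x) =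
      -(n * rate β x) := by
    intro x
    rw [rate]
    ring
  rw [charFun_map_magnetisation_div_eq_ratio (a := n / (2 * β)) (c := (1 : ℝ))
    (d := ((ξ / β : ℝ) : ℂ) * Complex.I) (e := 0) (κ := ((ξ ^ 2 / (2 * β) / n : ℝ) : ℂ))
    (by positivity)]
  · have h1 := fun x => exp_mul_cosh_pow n (n / (2 * β)) 1 x 0
    have h2 := fun x => exp_mul_cosh_pow n (n / (2 * β)) 1 x (((ξ / β : ℝ) : ℂ) * Complex.I)
    simp only [hexp, zero_mul, add_zero, Complex.exp_zero, one_mul] at h1 h2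
    simp only [add_zero, h1, h2]
    rw [integral_cexp_mul_even hint fun u => by rw [← rate_abs, abs_neg, rate_abs],
      integral_complex_ofReal, Function.comp_apply]
    push_cast
    rfl
  · intro s
    push_cast
    field_simp
    ring
  · intro s
    push_cast
    field_simp
    ring_nf
    simp only [Complex.I_sq]
    ring

/-! ### The Gamma representation of the quartic law. -/

/-- Substitute `x = (12 g)^(1/4)`: the Gamma weight `g^(-3/4) dg` is `4 d(g^(1/4))`, so only `exp
(-x⁴ / 12)` remains. -/
theorem integral_gammaMeasure_quarter (φ : ℝ → ℂ) :
    ∫ g, φ ((12 * g) ^ (1 / 4 : ℝ)) ∂gammaMeasure (1 / 4) 1 =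
      (4 / ((12 : ℝ) ^ (1 / 4 : ℝ) * Real.Gamma (1 / 4)) : ℝ) *
        ∫ x in Set.Ioi 0, φ x * (Real.exp (-(x ^ 4 / 12)) : ℝ) := by
  have hG : Real.Gamma (1 / 4) ≠ 0 := (Real.Gamma_pos_of_pos (by norm_num)).ne'
  have h12 : (0 : ℝ) < 12 ^ (1 / 4 : ℝ) := by positivity
  have hscale := integral_comp_mul_left_Ioi
    (fun x : ℝ => φ x * (Real.exp (-(x ^ 4 / 12)) : ℝ)) 0 h12
  rw [mul_zero] at hscale
  have hpow := integral_comp_rpow_Ioi_of_pos (p := 1 / 4) (by norm_num)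
    (g := fun x : ℝ => φ (12 ^ (1 / 4 : ℝ) * x) *
      (Real.exp (-((12 ^ (1 / 4 : ℝ) * x) ^ 4 / 12)) : ℝ))
  have h4 : ∀ y : ℝ, 0 ≤ y → (y ^ (1 / 4 : ℝ)) ^ 4 = y := fun y hy => by
    rw [← Real.rpow_natCast, ← Real.rpow_mul hy]; norm_num
  rw [gammaMeasure, integral_withDensity_eq_integral_toReal_smul
    (f := gammaPDF (1 / 4) 1) (measurable_gammaPDFReal _ _).ennreal_ofReal (ae_of_all _ fun x => ENNReal.ofReal_lt_top)]
  have hsupp : ∀ x : ℝ, x ∉ Set.Ici (0 : ℝ) →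
      (gammaPDF (1 / 4) 1 x).toReal • φ ((12 * x) ^ (1 / 4 : ℝ)) = 0 := by
    intro x hx
    rw [gammaPDF_of_neg (not_le.1 hx)]
    simp
  rw [← setIntegral_eq_integral_of_forall_compl_eq_zero hsupp, integral_Ici_eq_integral_Ioi]
  have hint : ∀ x ∈ Set.Ioi (0 : ℝ), (gammaPDF (1 / 4) 1 x).toReal • φ ((12 * x) ^ (1 / 4 : ℝ)) =
      ((4 / Real.Gamma (1 / 4) : ℝ) : ℂ) * ((1 / 4 * x ^ ((1 / 4 : ℝ) - 1)) •
        (φ (12 ^ (1 / 4 : ℝ) * x ^ (1 / 4 : ℝ)) *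
          (Real.exp (-((12 ^ (1 / 4 : ℝ) * x ^ (1 / 4 : ℝ)) ^ 4 / 12)) : ℝ))) := by
    intro x hx
    have hx0 : 0 ≤ x := le_of_lt hx
    rw [gammaPDF_of_nonneg hx0, ENNReal.toReal_ofReal (by positivity), mul_pow _ _ 4,
      h4 _ (by norm_num), h4 _ hx0, Real.mul_rpow (by norm_num) hx0, Complex.real_smul,
      Complex.real_smul]
    rw [mul_div_cancel_left₀ x (by norm_num : (12 : ℝ) ≠ 0), one_mul, Real.one_rpow]
    push_cast
    ring
  rw [setIntegral_congr_fun measurableSet_Ioi hint, integral_const_mul, hpow, hscale,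
    Complex.real_smul]
  push_cast
  field_simp

/-- The two signs carry the half-line integral to `(0, ∞)` and `(-∞, 0]`, each with weight `1/2`,
which turns the constant `4` into `2`. -/
theorem integral_signLaw_prod_gammaMeasure (ξ : ℝ) :
    ∫ p : ℝ × ℝ, Complex.exp (ξ * (p.1 * (12 * p.2) ^ (1 / 4 : ℝ) : ℝ) * Complex.I)
        ∂signLaw.prod (gammaMeasure (1 / 4) 1) =
      (2 / ((12 : ℝ) ^ (1 / 4 : ℝ) * Real.Gamma (1 / 4)) : ℝ) *
        ∫ x : ℝ, Complex.exp (ξ * Complex.I * x) *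
          (Real.exp (-(x ^ 4 / 12)) : ℝ) := by
  have : IsProbabilityMeasure (gammaMeasure (1 / 4) 1) :=
    isProbabilityMeasure_gammaMeasure (by norm_num) one_pos
  have hb : Integrable (fun p : ℝ × ℝ =>
      Complex.exp (ξ * (p.1 * (12 * p.2) ^ (1 / 4 : ℝ) : ℝ) * Complex.I))
      (signLaw.prod (gammaMeasure (1 / 4) 1)) := by
    refine Integrable.of_bound (C := 1) (Measurable.aestronglyMeasurable (by fun_prop))
      (ae_of_all _ fun p => ?_)
    rw [← Complex.ofReal_mul, Complex.norm_exp_ofReal_mul_I]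
  rw [integral_prod _ hb, integral_signLaw,
    integral_gammaMeasure_quarter fun y => Complex.exp (ξ * (1 * y : ℝ) * Complex.I),
    integral_gammaMeasure_quarter fun y => Complex.exp (ξ * (-1 * y : ℝ) * Complex.I)]
  have hw : Integrable fun x : ℝ => Real.exp (-(x ^ 4 / 12)) := by
    simpa using integrable_exp_quartic 0
  have hi : Integrable fun x : ℝ => Complex.exp (ξ * Complex.I * x) *
      (Real.exp (-(x ^ 4 / 12)) : ℝ) :=
    hw.ofReal.bdd_mul (c := 1) (by fun_prop) (ae_of_all _ fun u => by
      rw [show (ξ : ℂ) * Complex.I * u = ((ξ * u : ℝ) : ℂ) * Complex.I by push_cast; ring,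
        Complex.norm_exp_ofReal_mul_I])
  have hneg := integral_comp_neg_Ioi 0 fun x : ℝ => Complex.exp (ξ * Complex.I * x) *
      ((Real.exp (-(x ^ 4 / 12)) : ℝ) : ℂ)
  rw [neg_zero] at hneg
  have h1 : ∫ x in Set.Ioi (0 : ℝ), Complex.exp (ξ * (-1 * x : ℝ) * Complex.I) *
      ((Real.exp (-(x ^ 4 / 12)) : ℝ) : ℂ) =
      ∫ x in Set.Iic (0 : ℝ), Complex.exp (ξ * Complex.I * x) *
        ((Real.exp (-(x ^ 4 / 12)) : ℝ) : ℂ) := by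
    rw [← hneg]
    congr 1
    ext x
    rw [Even.neg_pow (by decide : Even 4)]
    push_cast
    ring_nf
  have h2 : ∫ x in Set.Ioi (0 : ℝ), Complex.exp (ξ * (1 * x : ℝ) * Complex.I) *
      ((Real.exp (-(x ^ 4 / 12)) : ℝ) : ℂ) =
      ∫ x in Set.Ioi (0 : ℝ), Complex.exp (ξ * Complex.I * x) *
        ((Real.exp (-(x ^ 4 / 12)) : ℝ) : ℂ) := by
    congr 1
    ext x
    rw [one_mul, mul_right_comm]
  rw [h1, h2, ← intervalIntegral.integral_Iic_add_Ioi hi.integrableOn hi.integrableOn (b := 0)]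
  push_cast
  ring

theorem hasLaw_sign_mul_gamma_rpow {Ω : Type*} [MeasurableSpace Ω] {P : Measure Ω}
    [IsProbabilityMeasure P] {B G : Ω → ℝ} (hB : HasLaw B signLaw P)
    (hG : HasLaw G (gammaMeasure (1 / 4) 1) P) (hBG : IndepFun B G P) :
    HasLaw (fun ω => B ω * (12 * G ω) ^ (1 / 4 : ℝ)) (quarticLaw 0) P := by
  have hBm := hB.aemeasurable
  have hGm := hG.aemeasurable
  have hX : AEMeasurable (fun ω => B ω * (12 * G ω) ^ (1 / 4 : ℝ)) P := by fun_prop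
  refine ⟨hX, ?_⟩
  have : IsProbabilityMeasure (P.map fun ω => B ω * (12 * G ω) ^ (1 / 4 : ℝ)) :=
    Measure.isProbabilityMeasure_map hX
  have hjoint := (indepFun_iff_map_prod_eq_prod_map_map hBm hGm).1 hBG
  rw [hB.map_eq, hG.map_eq] at hjoint
  have hchar : ∀ ξ : ℝ, charFun (P.map fun ω => B ω * (12 * G ω) ^ (1 / 4 : ℝ)) ξ =
      (2 / ((12 : ℝ) ^ (1 / 4 : ℝ) * Real.Gamma (1 / 4)) : ℝ) *
        ∫ x : ℝ, Complex.exp (ξ * Complex.I * x) *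
          (Real.exp (-(x ^ 4 / 12)) : ℝ) := by
    intro ξ
    rw [← integral_signLaw_prod_gammaMeasure, ← hjoint, charFun_apply_real,
      integral_map hX (by fun_prop), integral_map (hBm.prodMk hGm)
        (Measurable.aestronglyMeasurable (by fun_prop))]
  -- At `ξ = 0` total mass one identifies the constant as the inverse of the quartic normalisation,
  -- so the value of `Γ(1/4)` is never needed.
  have hZ := hchar 0
  simp only [charFun_zero, probReal_univ, Complex.ofReal_zero, zero_mul,
    Complex.exp_zero, one_mul, Complex.ofReal_one] at hZ
  refine Measure.ext_of_charFun (funext fun ξ => ?_)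
  have hq := charFun_quarticLaw 0 ξ
  simp only [neg_zero, zero_mul, zero_div, zero_sub] at hq
  rw [hchar, hq, eq_div_iff (right_ne_zero_of_mul (hZ ▸ one_ne_zero)),
    mul_right_comm, ← hZ, one_mul]

end CurieWeiss

theorem theorem1 :
    -- subcritical regime
    (∀ β : ℝ, β < 1 →
      TendstoInDistribution
        (fun n x => CurieWeiss.magnetisation n x / √(n : ℝ)) atTop
        (fun z : ℝ => z)
        (fun n => CurieWeiss.spinLaw n β) (gaussianReal 0 (1 / (1 - β)).toNNReal)) ∧
    -- critical temperature
    (TendstoInDistribution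
        (fun n x => CurieWeiss.magnetisation n x / (n : ℝ) ^ (3 / 4 : ℝ)) atTop
        (fun z : ℝ => z)
        (fun n => CurieWeiss.spinLaw n 1) (CurieWeiss.quarticLaw 0) ∧
      ∀ (Ω : Type*) [MeasurableSpace Ω] (P : Measure Ω) [IsProbabilityMeasure P] (B G : Ω → ℝ),
        HasLaw B CurieWeiss.signLaw P → HasLaw G (gammaMeasure (1 / 4) 1) P → IndepFun B G P →
        HasLaw (fun ω => B ω * (12 * G ω) ^ (1 / 4 : ℝ)) (CurieWeiss.quarticLaw 0) P) ∧
    -- critical window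
    (∀ γ : ℝ,
      TendstoInDistribution
        (fun n x => CurieWeiss.magnetisation n x / (n : ℝ) ^ (3 / 4 : ℝ)) atTop
        (fun z : ℝ => z)
        (fun n => CurieWeiss.spinLaw n (1 - γ / √(n : ℝ))) (CurieWeiss.quarticLaw γ)) ∧
    -- supercritical regime
    (∀ β : ℝ, 1 < β →
      ∃ t : ℝ, 0 < t ∧ t = Real.tanh (β * t) ∧
        (∀ s : ℝ, 0 < s → s = Real.tanh (β * s) → s = t) ∧
        TendstoInDistribution
          (fun n x => CurieWeiss.magnetisation n x / (n : ℝ)) atTop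
          (fun b : ℝ => t * b)
          (fun n => CurieWeiss.spinLaw n β) CurieWeiss.signLaw) := by
  refine ⟨fun β hβ => CurieWeiss.tendstoInDistribution_of_lt_one hβ, ⟨?_, ?_⟩,
    CurieWeiss.tendstoInDistribution_critical_window, fun β hβ => ?_⟩
  · simpa only [zero_div, sub_zero] using CurieWeiss.tendstoInDistribution_critical_window 0
  · intro Ω _ P _ B G hB hG hBG
    exact CurieWeiss.hasLaw_sign_mul_gamma_rpow hB hG hBG
  · obtain ⟨t, ht0, ht⟩ := CurieWeiss.exists_pos_eq_tanh hβ
    have hβ0 : 0 < β := one_pos.trans hβ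
    exact ⟨t, ht0, ht, fun s hs0 hs => CurieWeiss.eq_of_eq_tanh hβ0 hs0 hs ht0 ht,
      CurieWeiss.tendstoInDistribution_of_eq_tanh hβ0 ht0 ht⟩
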